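/- Let $p$ be a prime number, let $g=(p+1)X^p+p^2Y^p-1\in\mathbb{Z}[X,Y]$ and let $D=\mathbb{Z}[X,Y]/(g)$. Then $D$ is a regular ring (that is, $D$ is Noetherian and its localization at every prime ideal is a regular local ring), but $D$ is not smooth over $\mathbb{Z}$. Moreover, the jacobian ideal $J$ of $D$ over $\mathbb{Z}$, that is, the ideal of $D$ generated by the images of $\partial g/\partial X$ and $\partial g/\partial Y$, is $J=(p,\,X^p-1)D$, and $J\neq D$. -/

import Mathlib

/-- The coordinate ring `R[X_i : i ∈ σ] / (f)` of the hypersurface `f = 0`. -/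
abbrev HypersurfaceRing {σ R : Type*} [CommRing R] (f : MvPolynomial σ R) : Type _ :=
  MvPolynomial σ R ⧸ Ideal.span {f}

/-- The jacobian ideal of `R[X_i : i ∈ σ] / (f)` over `R`: the ideal of the quotient ring generated
by the images of the entries `∂f/∂X_i` of the (one-row) Jacobian matrix. -/
noncomputable def hypersurfaceJacobianIdeal {σ R : Type*} [CommRing R] (f : MvPolynomial σ R) :
    Ideal (HypersurfaceRing f) :=
  Ideal.span (Set.range fun i : σ => Ideal.Quotient.mk (Ideal.span {f}) (MvPolynomial.pderiv i f))

/-- The polynomial `(p + 1) X ^ p + p ^ 2 Y ^ p - 1` in `ℤ[X, Y]`, where `X` and `Y` are the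
variables of index `0` and `1`. -/
noncomputable def diagonalPoly (p : ℕ) : MvPolynomial (Fin 2) ℤ :=
  MvPolynomial.C ((p : ℤ) + 1) * MvPolynomial.X 0 ^ p
    + MvPolynomial.C ((p : ℤ) ^ 2) * MvPolynomial.X 1 ^ p - 1

open MvPolynomial

/-! Since `ℤ[X, Y]` is regular, `D` is regular once `g` avoids the square of the maximal ideal at
each prime `Q ∋ g`. Suppose `s * g ∈ Q ^ 2` with `s ∉ Q`. Ordinary derivations put both partials of
`g` in `Q`, and an Euler-type relation then gives `p ∈ Q`. Modulo `p`, `g` is `(X - 1) ^ p`, so `X -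
1 ∈ Q`, `X ^ p - 1 ∈ Q ^ 2` and `g ≡ p` modulo `Q ^ 2`. Thus `s * p ∈ Q ^ 2`, which the
`p`-derivation attached to the Frobenius lift `expand p` excludes. Smoothness fails because the
point `(1, 0)` over `𝔽_p` does not lift to `ℤ/p²`. -/

theorem MvPolynomial.natCast_dvd_expand_sub_pow {σ : Type*} {p : ℕ} (hp : p.Prime)
    (a : MvPolynomial σ ℤ) : (p : MvPolynomial σ ℤ) ∣ expand p a - a ^ p := by
  have : Fact p.Prime := ⟨hp⟩
  rw [← C_eq_coe_nat, C_dvd_iff_zmod, map_sub, sub_eq_zero, map_expand, map_pow,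
    MvPolynomial.expand_zmod]

/-- The quotient `(expand p c - c ^ p) / p` is a `p`-derivation, so it maps the square of an ideal
containing `p` into the ideal. -/
theorem MvPolynomial.expand_sub_pow_mem_span_mul {σ : Type*} {p : ℕ} (hp : p.Prime)
    {Q : Ideal (MvPolynomial σ ℤ)} (hpQ : (p : MvPolynomial σ ℤ) ∈ Q)
    {c : MvPolynomial σ ℤ} (hc : c ∈ Q ^ 2) :
    expand p c - c ^ p ∈ Ideal.span {(p : MvPolynomial σ ℤ)} * Q := by
  -- Membership in `Q` is carried along because the `p`-derivation is not additive: a sum produces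
  -- an error term `a * b * r`.
  suffices h : c ∈ Q ∧ expand p c - c ^ p ∈ Ideal.span {(p : MvPolynomial σ ℤ)} * Q from h.2
  rw [pow_two] at hc
  simp only [Ideal.mem_span_singleton_mul]
  induction hc using Submodule.mul_induction_on' with
  | mem_mul_mem a ha b hb =>
    refine ⟨Q.mul_mem_left a hb, ?_⟩
    obtain ⟨α, hα⟩ := natCast_dvd_expand_sub_pow hp a
    obtain ⟨β, hβ⟩ := natCast_dvd_expand_sub_pow hp b
    refine ⟨a ^ p * β + α * b ^ p + p * (α * β), ?_, ?_⟩
    · exact Q.add_mem (Q.add_mem (Q.mul_mem_right _ (Q.pow_mem_of_mem ha p hp.pos))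
        (Q.mul_mem_left _ (Q.pow_mem_of_mem hb p hp.pos))) (Q.mul_mem_right _ hpQ)
    · rw [map_mul, mul_pow, eq_add_of_sub_eq hα, eq_add_of_sub_eq hβ]
      ring
  | add a _ b _ iha ihb =>
    obtain ⟨ha, α, hα, hα'⟩ := iha
    obtain ⟨hb, β, hβ, hβ'⟩ := ihb
    obtain ⟨r, hr⟩ := exists_add_pow_prime_eq hp a b
    refine ⟨Q.add_mem ha hb, α + β - a * (b * r), ?_, ?_⟩
    · exact Q.sub_mem (Q.add_mem hα hβ) (Q.mul_mem_right _ ha)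
    · rw [map_add, hr]
      linear_combination hα' + hβ'

/-- The `p`-derivation sends `s * p` to `expand p s - p ^ (p - 1) * s ^ p`, which is `s ^ p` modulo
`p` because `p ≥ 2`. -/
theorem MvPolynomial.mem_of_mul_natCast_mem_sq {σ : Type*} {p : ℕ} (hp : p.Prime)
    {Q : Ideal (MvPolynomial σ ℤ)} [Q.IsPrime] (hpQ : (p : MvPolynomial σ ℤ) ∈ Q)
    {s : MvPolynomial σ ℤ} (hs : s * p ∈ Q ^ 2) : s ∈ Q := by
  obtain ⟨d, hd, h⟩ := Ideal.mem_span_singleton_mul.mp (expand_sub_pow_mem_span_mul hp hpQ hs)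
  obtain ⟨e, he⟩ := natCast_dvd_expand_sub_pow hp s
  obtain ⟨n, rfl⟩ := Nat.exists_eq_add_of_le hp.two_le
  set p := 2 + n
  have hp0 : (p : MvPolynomial σ ℤ) ≠ 0 := by exact_mod_cast hp.ne_zero
  have h2 : s ^ p = d + p * (s ^ p * p ^ n - e) := by
    apply mul_left_cancel₀ hp0
    rw [map_mul, map_natCast, eq_add_of_sub_eq he, mul_pow,
      show (p : MvPolynomial σ ℤ) ^ p = p * (p * p ^ n) by
        rw [← pow_succ', ← pow_succ']; congr 1; omega] at h
    linear_combination -h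
  refine Ideal.IsPrime.mem_of_pow_mem ‹_› p ?_
  rw [h2]
  exact Q.add_mem hd (Q.mul_mem_right _ hpQ)

theorem Derivation.mem_of_mul_mem_sq {R A : Type*} [CommRing R] [CommRing A] [Algebra R A]
    (D : Derivation R A A) {Q : Ideal A} [hQ : Q.IsPrime] {s g : A} (hs : s ∉ Q) (hg : g ∈ Q)
    (h : s * g ∈ Q ^ 2) : D g ∈ Q := by
  have key : ∀ c ∈ Q ^ 2, D c ∈ Q := by
    intro c hc
    rw [pow_two] at hc
    induction hc using Submodule.mul_induction_on' with
    | mem_mul_mem a ha b hb =>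
      rw [D.leibniz]
      exact Q.add_mem (Q.mul_mem_right _ ha) (Q.mul_mem_right _ hb)
    | add a _ b _ iha ihb => rw [map_add]; exact Q.add_mem iha ihb
  have h2 := key _ h
  rw [D.leibniz, smul_eq_mul, smul_eq_mul] at h2
  exact (hQ.mem_or_mem ((Q.add_mem_iff_left (Q.mul_mem_right _ hg)).mp h2)).resolve_left hs

theorem pderiv_zero_diagonalPoly (p : ℕ) : pderiv 0 (diagonalPoly p) =
    ((p : MvPolynomial (Fin 2) ℤ) + 1) * (p * (X 0 : MvPolynomial (Fin 2) ℤ) ^ (p - 1)) := by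
  simp [diagonalPoly, Derivation.leibniz_pow]

theorem pderiv_one_diagonalPoly (p : ℕ) : pderiv 1 (diagonalPoly p) =
    (p : MvPolynomial (Fin 2) ℤ) ^ 2 * (p * (X 1 : MvPolynomial (Fin 2) ℤ) ^ (p - 1)) := by
  simp [diagonalPoly, Derivation.leibniz_pow]

theorem diagonalPoly_eq (p : ℕ) : diagonalPoly p =
    ((p : MvPolynomial (Fin 2) ℤ) + 1) * (X 0 : MvPolynomial (Fin 2) ℤ) ^ p +
      (p : MvPolynomial (Fin 2) ℤ) ^ 2 * X 1 ^ p - 1 := by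
  simp [diagonalPoly]

/-- Euler's relation: `g + 1` is homogeneous of degree `p`. -/
theorem natCast_eq_pderiv_diagonalPoly {p : ℕ} (hp : p ≠ 0) :
    (p : MvPolynomial (Fin 2) ℤ) = (X 0 : MvPolynomial (Fin 2) ℤ) * pderiv 0 (diagonalPoly p) +
      X 1 * pderiv 1 (diagonalPoly p) -
      (p : MvPolynomial (Fin 2) ℤ) * diagonalPoly p := by
  obtain ⟨n, rfl⟩ := Nat.exists_eq_succ_of_ne_zero hp
  rw [pderiv_zero_diagonalPoly, pderiv_one_diagonalPoly, diagonalPoly_eq, Nat.succ_sub_one]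
  simp only [Nat.succ_eq_add_one, pow_succ]
  ring

theorem mul_diagonalPoly_notMem_sq {p : ℕ} (hp : p.Prime) {Q : Ideal (MvPolynomial (Fin 2) ℤ)}
    [hQ : Q.IsPrime] (hg : diagonalPoly p ∈ Q) {s : MvPolynomial (Fin 2) ℤ} (hs : s ∉ Q) :
    s * diagonalPoly p ∉ Q ^ 2 := by
  intro h
  have hpQ : (p : MvPolynomial (Fin 2) ℤ) ∈ Q := by
    rw [natCast_eq_pderiv_diagonalPoly hp.ne_zero]
    exact Q.sub_mem (Q.add_mem (Q.mul_mem_left _ (Derivation.mem_of_mul_mem_sq _ hs hg h))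
      (Q.mul_mem_left _ (Derivation.mem_of_mul_mem_sq _ hs hg h))) (Q.mul_mem_left _ hg)
  obtain ⟨r, hr⟩ := exists_add_pow_prime_eq hp (X 0 - 1 : MvPolynomial (Fin 2) ℤ) 1
  rw [sub_add_cancel, one_pow] at hr
  have hXQ : (X 0 - 1 : MvPolynomial (Fin 2) ℤ) ∈ Q := by
    refine hQ.mem_of_pow_mem p ?_
    have : (X 0 - 1 : MvPolynomial (Fin 2) ℤ) ^ p = diagonalPoly p -
        (p : MvPolynomial (Fin 2) ℤ) * (X 0 ^ p + (p : MvPolynomial (Fin 2) ℤ) * (X 1 : MvPolynomial (Fin 2) ℤ) ^ p + (X 0 - 1) * r) := by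
      rw [diagonalPoly_eq]
      linear_combination -hr
    rw [this]
    exact Q.sub_mem hg (Q.mul_mem_right _ hpQ)
  have hpow : (X 0 ^ p - 1 : MvPolynomial (Fin 2) ℤ) ∈ Q ^ 2 := by
    rw [show (X 0 ^ p - 1 : MvPolynomial (Fin 2) ℤ) = (X 0 - 1) ^ p +
        (p : MvPolynomial (Fin 2) ℤ) * (X 0 - 1) * r by
      linear_combination hr]
    refine (Q ^ 2).add_mem (Ideal.pow_le_pow_right hp.two_le (Ideal.pow_mem_pow hXQ p))
      ((Q ^ 2).mul_mem_right _ ?_)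
    rw [pow_two]
    exact Ideal.mul_mem_mul hpQ hXQ
  refine hs (mem_of_mul_natCast_mem_sq hp hpQ ?_)
  have : s * (p : MvPolynomial (Fin 2) ℤ) = s * diagonalPoly p - 
      s * ((p : MvPolynomial (Fin 2) ℤ) + 1) * (X 0 ^ p - 1) - s * X 1 ^ p * (p : MvPolynomial (Fin 2) ℤ) ^ 2 := by
    rw [diagonalPoly_eq]
    ring
  rw [this]
  exact (Q ^ 2).sub_mem ((Q ^ 2).sub_mem h ((Q ^ 2).mul_mem_left _ hpow))
    ((Q ^ 2).mul_mem_left _ (Ideal.pow_mem_pow hpQ 2))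

theorem hypersurfaceJacobianIdeal_diagonalPoly {p : ℕ} (hp : p ≠ 0) :
    hypersurfaceJacobianIdeal (diagonalPoly p) =
      Ideal.span {(p : HypersurfaceRing (diagonalPoly p))} := by
  set π := Ideal.Quotient.mk (Ideal.span {diagonalPoly p})
  refine le_antisymm (Ideal.span_le.mpr ?_) ((Ideal.span_singleton_le_iff_mem _).mpr ?_)
  · rintro _ ⟨i, rfl⟩
    refine Ideal.mem_span_singleton.mpr ?_
    rw [← map_natCast π]
    refine map_dvd π ?_
    fin_cases i
    · simp only [Fin.zero_eta, pderiv_zero_diagonalPoly]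
      exact (dvd_mul_right _ _).mul_left _
    · simp only [Fin.mk_one, pderiv_one_diagonalPoly]
      exact (dvd_mul_right _ _).mul_left _
  · have hmem (i : Fin 2) : π (pderiv i (diagonalPoly p)) ∈
        hypersurfaceJacobianIdeal (diagonalPoly p) := Ideal.subset_span ⟨i, rfl⟩
    rw [← map_natCast π, natCast_eq_pderiv_diagonalPoly hp, map_sub, map_add, map_mul, map_mul,
      map_mul, show π (diagonalPoly p) = 0 from
        Ideal.Quotient.eq_zero_iff_mem.mpr (Ideal.mem_span_singleton_self _), mul_zero, sub_zero]
    exact add_mem (Ideal.mul_mem_left _ _ (hmem 0)) (Ideal.mul_mem_left _ _ (hmem 1))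

theorem span_natCast_pow_sub_one_diagonalPoly (p : ℕ) :
    Ideal.span {(p : HypersurfaceRing (diagonalPoly p)),
        Ideal.Quotient.mk (Ideal.span {diagonalPoly p}) (X 0 ^ p - 1)} =
      Ideal.span {(p : HypersurfaceRing (diagonalPoly p))} := by
  rw [Ideal.span_insert, sup_eq_left, Ideal.span_singleton_le_span_singleton]
  refine ⟨Ideal.Quotient.mk _ (-X 0 ^ p - (p : MvPolynomial (Fin 2) ℤ) * X 1 ^ p), ?_⟩
  rw [← map_natCast (Ideal.Quotient.mk (Ideal.span {diagonalPoly p})), ← map_mul,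
    Ideal.Quotient.mk_eq_mk_iff_sub_mem, Ideal.mem_span_singleton, diagonalPoly_eq]
  exact ⟨1, by ring⟩

/-- The point `(1, 0)` of the hypersurface over a ring in which `p = 0`. -/
noncomputable def diagonalPolyPoint (p : ℕ) (B : Type*) [CommRing B] (hB : (p : B) = 0) :
    HypersurfaceRing (diagonalPoly p) →ₐ[ℤ] B :=
  Ideal.Quotient.liftₐ _ (aeval ![1, 0]) fun a ha ↦ by
    obtain ⟨b, rfl⟩ := Ideal.mem_span_singleton.mp ha
    simp [diagonalPoly_eq, hB]

theorem not_formallySmooth_diagonalPoly {p : ℕ} (hp : p.Prime) :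
    ¬ Algebra.FormallySmooth ℤ (HypersurfaceRing (diagonalPoly p)) := by
  intro h
  let B := ZMod (p ^ 2)
  let I : Ideal B := Ideal.span {(p : B)}
  have hp2 : (p : B) ^ 2 = 0 := by
    rw [← Nat.cast_pow]
    exact ZMod.natCast_self _
  have hI : IsNilpotent I := ⟨2, by rw [Ideal.span_singleton_pow, hp2]; simp⟩
  have hpI : (p : B ⧸ I) = 0 := by
    rw [← map_natCast (Ideal.Quotient.mk I)]
    exact Ideal.Quotient.eq_zero_iff_mem.mpr (Ideal.mem_span_singleton_self _)
  obtain ⟨f, hf⟩ := Algebra.FormallySmooth.exists_lift I hI (diagonalPolyPoint p (B ⧸ I) hpI)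
  let π := Ideal.Quotient.mkₐ ℤ (Ideal.span {diagonalPoly p})
  have hx : (p : B) ∣ f (π (X 0)) - 1 := by
    rw [← Ideal.mem_span_singleton, ← Ideal.Quotient.mk_eq_mk_iff_sub_mem, map_one]
    refine (AlgHom.congr_fun hf (π (X 0))).trans ?_
    exact (aeval_X _ _).trans rfl
  -- A congruence modulo `p` becomes one modulo `p ^ 2` after taking `p`-th powers; hence `g` takes
  -- the value `p ≠ 0` at any lift.
  have hxp : f (π (X 0)) ^ p = 1 := by
    have := dvd_sub_pow_of_dvd_sub hx 1
    rwa [one_add_one_eq_two, hp2, zero_dvd_iff, pow_one, one_pow, sub_eq_zero] at this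
  have h0 : f (π (diagonalPoly p)) = 0 := by
    rw [show π (diagonalPoly p) = 0 from
      Ideal.Quotient.eq_zero_iff_mem.mpr (Ideal.mem_span_singleton_self _), map_zero]
  replace h0 := (congrArg (fun a ↦ f (π a)) (diagonalPoly_eq p)).symm.trans h0
  simp only [map_sub, map_add, map_mul, map_pow, map_natCast, map_one, hxp, hp2] at h0
  have hp0 : (p : B) = 0 := by linear_combination h0
  have := Nat.le_of_dvd hp.pos ((ZMod.natCast_eq_zero_iff _ _).mp hp0)
  nlinarith [hp.two_le]


open IsLocalRing in
-- The class of `x` in the cotangent space is nonzero, so `x` belongs to a minimal generating set of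
-- the maximal ideal; the images of the other generators suffice for `S`.
theorem IsLocalRing.spanFinrank_maximalIdeal_add_one_le_of_surjective {R S : Type*} [CommRing R]
    [CommRing S] [IsLocalRing R] [IsLocalRing S] [IsNoetherianRing R] (f : R →+* S)
    (hf : Function.Surjective f) {x : R} (hx : x ∈ maximalIdeal R)
    (hx2 : x ∉ maximalIdeal R ^ 2) (hfx : f x = 0) :
    (maximalIdeal S).spanFinrank + 1 ≤ (maximalIdeal R).spanFinrank := by
  let k := ResidueField R
  let v : CotangentSpace R := (maximalIdeal R).toCotangent ⟨x, hx⟩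
  have hv : v ≠ 0 := fun h ↦ hx2 ((Ideal.toCotangent_eq_zero _ _).mp h)
  have hli : LinearIndepOn k id {v} := .singleton hv
  let T : Set (CotangentSpace R) := hli.extend (Set.subset_univ _)
  have hvT : v ∈ T := hli.subset_extend _ rfl
  let b : Module.Basis T k (CotangentSpace R) := Module.Basis.extend hli
  have hfin : Finite T := Module.Finite.finite_basis b
  have hTfin : T.Finite := hfin
  have hcard : T.ncard = (maximalIdeal R).spanFinrank := by
    rw [spanFinrank_maximalIdeal_eq_finrank_cotangentSpace, Module.finrank_eq_nat_card_basis b]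
    rfl
  have hspanT : Submodule.span k T = ⊤ := by
    have := b.span_eq
    rwa [Module.Basis.range_extend] at this
  let σ := Function.surjInv (maximalIdeal R).toCotangent_surjective
  have hσ : ∀ w, (maximalIdeal R).toCotangent (σ w) = w := Function.surjInv_eq _
  let s : Set (maximalIdeal R) := insert ⟨x, hx⟩ (σ '' (T \ {v}))
  have himg : (maximalIdeal R).toCotangent '' s = T := by
    rw [Set.image_insert_eq, Set.image_image]
    simp only [hσ, Set.image_id']
    exact Set.insert_sdiff_self_of_mem hvT
  have hspan : Submodule.span R s = ⊤ := by
    rw [← CotangentSpace.span_image_eq_top_iff, himg]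
    exact hspanT
  have hmR : maximalIdeal R = Ideal.span (Subtype.val '' s) := by
    have := congrArg (Submodule.map (maximalIdeal R).subtype) hspan
    rw [Submodule.map_span, Submodule.map_subtype_top] at this
    exact this.symm
  have hmap := map_maximalIdeal_of_surjective f hf
  have hmS : maximalIdeal S = Ideal.span ((fun w ↦ f (σ w)) '' (T \ {v})) := by
    rw [← hmap, congrArg (Ideal.map f) hmR, Ideal.map_span, Set.image_insert_eq,
      Set.image_insert_eq, hfx,
      Ideal.span_insert_zero, Set.image_image, Set.image_image]
  have hle : (maximalIdeal S).spanFinrank ≤ (T \ {v}).ncard := by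
    rw [hmS]
    exact (Submodule.spanFinrank_span_le_ncard_of_finite (hTfin.sdiff.image _)).trans
      (Set.ncard_image_le hTfin.sdiff)
  rw [← hcard, ← Set.ncard_sdiff_singleton_add_one hvT hTfin]
  omega

open IsLocalRing in
-- Passing to the quotient lowers the embedding dimension by at least one and the height by at most
-- one.
theorem IsRegularLocalRing.localization_quotient_span_singleton {R : Type*} [CommRing R]
    [IsNoetherianRing R] {g : R} (q : Ideal (R ⧸ Ideal.span {g})) [q.IsPrime]
    [IsRegularLocalRing (Localization.AtPrime (q.comap (Ideal.Quotient.mk (Ideal.span {g}))))]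
    (hg : algebraMap R (Localization.AtPrime (q.comap (Ideal.Quotient.mk (Ideal.span {g})))) g ∉
      maximalIdeal (Localization.AtPrime (q.comap (Ideal.Quotient.mk (Ideal.span {g})))) ^ 2) :
    IsRegularLocalRing (Localization.AtPrime q) := by
  let π := Ideal.Quotient.mk (Ideal.span {g})
  have hπg : π g = 0 := Ideal.Quotient.eq_zero_iff_mem.mpr (Ideal.mem_span_singleton_self g)
  have hgQ : g ∈ q.comap π := by simp [Ideal.mem_comap, hπg]
  have h1 := spanFinrank_maximalIdeal_add_one_le_of_surjective
    (Localization.localRingHom (q.comap π) q π rfl)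
    (RingHom.surjective_localRingHom_of_surjective π Ideal.Quotient.mk_surjective q)
    ((IsLocalization.AtPrime.to_map_mem_maximal_iff _ (q.comap π) g).mpr hgQ) hg
    (by rw [Localization.localRingHom_to_map, hπg, map_zero])
  have h2 := (isRegularLocalRing_iff (Localization.AtPrime (q.comap π))).mp inferInstance
  have h3 := Ideal.height_le_height_add_one_of_mem hgQ
  rw [Ideal.map_comap_of_surjective _ Ideal.Quotient.mk_surjective] at h3
  refine of_spanFinrank_maximalIdeal_le _ ?_
  rw [IsLocalization.AtPrime.ringKrullDim_eq_height (q.comap π)] at h2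
  rw [IsLocalization.AtPrime.ringKrullDim_eq_height q]
  have h2' : ((maximalIdeal (Localization.AtPrime (q.comap π))).spanFinrank : ℕ∞) =
    (q.comap π).height := by exact_mod_cast h2
  rw [← h2'] at h3
  have h4 : ((maximalIdeal (Localization.AtPrime q)).spanFinrank : ℕ∞) + 1 ≤ q.height + 1 :=
    le_trans (by exact_mod_cast h1) h3
  exact_mod_cast (ENat.add_le_add_iff_right ENat.one_ne_top).mp h4

theorem mainTheorem6 (p : ℕ) (hp : p.Prime) :
    IsRegularRing (HypersurfaceRing (diagonalPoly p)) ∧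
    ¬ Algebra.Smooth ℤ (HypersurfaceRing (diagonalPoly p)) ∧
    hypersurfaceJacobianIdeal (diagonalPoly p) =
      Ideal.span {(p : HypersurfaceRing (diagonalPoly p)),
        Ideal.Quotient.mk (Ideal.span {diagonalPoly p}) (MvPolynomial.X 0 ^ p - 1)} ∧
    hypersurfaceJacobianIdeal (diagonalPoly p) ≠ ⊤ := by
  refine ⟨?_, fun h ↦ not_formallySmooth_diagonalPoly hp h.formallySmooth, ?_, ?_⟩
  · refine isRegularRing_iff.mpr fun q hq ↦ ?_
    let π := Ideal.Quotient.mk (Ideal.span {diagonalPoly p})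
    refine IsRegularLocalRing.localization_quotient_span_singleton q fun h ↦ ?_
    rw [← Localization.AtPrime.map_eq_maximalIdeal, ← Ideal.map_pow,
      IsLocalization.algebraMap_mem_map_algebraMap_iff (q.comap π).primeCompl] at h
    obtain ⟨s, hs, h⟩ := h
    refine mul_diagonalPoly_notMem_sq hp ?_ hs h
    rw [Ideal.mem_comap, Ideal.Quotient.eq_zero_iff_mem.mpr (Ideal.mem_span_singleton_self _)]
    exact q.zero_mem
  · rw [hypersurfaceJacobianIdeal_diagonalPoly hp.ne_zero, span_natCast_pow_sub_one_diagonalPoly]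
  · rw [hypersurfaceJacobianIdeal_diagonalPoly hp.ne_zero, Ne, Ideal.span_singleton_eq_top]
    intro h
    have : Fact p.Prime := ⟨hp⟩
    have h2 := h.map (diagonalPolyPoint p (ZMod p) (ZMod.natCast_self p))
    rw [map_natCast, ZMod.natCast_self] at h2
    exact not_isUnit_zero h2
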